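/- An overpartition of an integer $n\ge 0$ is a nonincreasing sequence of positive integers with sum $n$ in which the first occurrence of each number may be overlined. It is odd-even if its smallest part is odd and the difference between any two successive parts is odd when the smaller one is not overlined and even when the smaller one is overlined. Let $\overline{OE}(n)$ be the number of odd-even overpartitions of $n$, with $\overline{OE}(0)=1$, and let $$\overline{\mathscr O}(q)=\sum_{n\ge 0}\overline{OE}(n)\,q^n ,$$ a series that converges absolutely for $|q|<1$. Write $\tau=x+iy$ with $x\in\mathbb R$, $y>0$, and $q=e^{2\pi i\tau}$. Let $M>\sqrt{\left(\frac{12}{12-\pi^2}\right)^2-1}$. Then there is an $\epsilon>0$ such that, as $y\to 0^+$ and uniformly in $x$ with $My<|x|\le \frac12$, $$\overline{\mathscr O}(q)\ll \frac{1}{y\sqrt2}\,e^{\frac1y\left(\frac{\pi}{24}-\epsilon\right)} .$$ That is, there are constants $\epsilon,C,y_0>0$, depending only on $M$, such that $|\overline{\mathscr O}(q)|\le \frac{C}{y\sqrt2}\,e^{\frac1y\left(\frac{\pi}{24}-\epsilon\right)}$ whenever $0<y<y_0$ and $My<|x|\le\frac12$. -/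

import Mathlib

/-- An overpartition of `n`: a nonincreasing list of positive integers with sum `n`, in which the
first occurrence of each number may be overlined. An entry `(k, b)` is a part of size `k`, and
`b = true` means that this part is overlined. -/
structure Overpartition (n : ℕ) where
  /-- The parts, from the largest to the smallest, each with its overline mark. -/
  parts : List (ℕ × Bool)
  parts_pos : ∀ p ∈ parts, 0 < p.1
  sum_parts : (parts.map Prod.fst).sum = n
  nonincreasing : parts.Pairwise (fun p r => r.1 ≤ p.1)
  overlined_first : parts.Pairwise (fun p r => r.2 = true → r.1 ≠ p.1)

namespace Overpartition

/-- The smallest part (if there is one) is odd, and the difference between successive parts is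
even if the smaller one is overlined and odd if the smaller one is not overlined. Here `p` comes
just before `r` in the list, so `r.1 ≤ p.1`. -/
def IsOddEven {n : ℕ} (l : Overpartition n) : Prop :=
  (∀ p ∈ l.parts.getLast?, Odd p.1) ∧
    l.parts.IsChain (fun p r =>
      (r.2 = true → Even (p.1 - r.1)) ∧ (r.2 = false → Odd (p.1 - r.1)))

/-- There are finitely many overpartitions of `n`, so that counting them by `Nat.card` is
meaningful. -/
instance finite (n : ℕ) : Finite (Overpartition n) := by
  have hlen : ∀ L : List (ℕ × Bool), (∀ p ∈ L, 0 < p.1) → L.length ≤ (L.map Prod.fst).sum := by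
    intro L
    induction L with
    | nil => simp
    | cons a t ih =>
      intro h
      have h1 := h a (by simp)
      have h2 := ih (fun p hp => h p (by simp [hp]))
      simp only [List.length_cons, List.map_cons, List.sum_cons]
      omega
  have hle : ∀ (l : Overpartition n), ∀ p ∈ l.parts, p.1 < n + 1 := by
    intro l p hp
    have h1 : p.1 ≤ (l.parts.map Prod.fst).sum :=
      List.single_le_sum (by simp) _ (List.mem_map_of_mem hp)
    rw [l.sum_parts] at h1
    omega
  let F : Overpartition n → {L : List (Fin (n + 1) × Bool) // L.length ≤ n} := fun l =>
    ⟨l.parts.map (fun p => (Fin.ofNat (n + 1) p.1, p.2)), by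
      have h := hlen l.parts l.parts_pos
      rw [l.sum_parts] at h
      simpa using h⟩
  have : Finite {L : List (Fin (n + 1) × Bool) // L.length ≤ n} :=
    (List.finite_length_le (Fin (n + 1) × Bool) n).to_subtype
  have hback : ∀ l : Overpartition n,
      (F l).1.map (fun p => ((p.1 : ℕ), p.2)) = l.parts := by
    intro l
    simp only [F, List.map_map]
    conv_rhs => rw [← List.map_id l.parts]
    apply List.map_congr_left
    intro p hp
    have h := hle l p hp
    simp [Nat.mod_eq_of_lt h]
  refine Finite.of_injective F ?_
  intro l₁ l₂ h
  have h' : l₁.parts = l₂.parts := by rw [← hback l₁, ← hback l₂, h]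
  cases l₁
  cases l₂
  simp_all

end Overpartition

/-- The number of odd-even overpartitions of `n`. For `n = 0` only the empty list is counted, so
the value is `1`. -/
noncomputable def oddEvenOverpartitionCount (n : ℕ) : ℕ :=
  Nat.card {l : Overpartition n // l.IsOddEven}

/-- The generating function of the odd-even overpartitions, for `‖q‖ < 1`. -/
noncomputable def oddEvenOverpartitionGF (q : ℂ) : ℂ :=
  ∑' n : ℕ, (oddEvenOverpartitionCount n : ℂ) * q ^ n

/-! In an odd-even overpartition the parts are distinct and parity forces every overline mark except
that of the largest part. So the series is 1 + 2 ∑ q^(∑S) over finite sets S with odd minimum, and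
sorting by the minimum m bounds it by products of |1 + q^j| over j > m, weighted by |q|^m
(`sum_powerset_range_hasOddMin`). With |q| = e^(-t), t = 2πy, the product of 1 + |q|^j is at most a
constant times e^(π²/(12t)) = e^(π/(24y)). The saving comes from j ≤ N ≈ 1/(My): there |q|^j is
bounded below, so |1 + q^j| gains a factor e^(-s(1 - cos 2πjx)) (`norm_one_add_le`). As |x| > My,
the Dirichlet kernel keeps the cosines from adding up (`le_sum_one_sub_cos`), and the total gain is
e^(-s/(2My)). -/

/-! ### Upper bound for the product of 1 + r^j -/

open Finset in
theorem prod_one_add_pow_mul_prod_one_sub_pow (r : ℝ) (n : ℕ) :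
    (∏ j ∈ range n, (1 + r ^ (j + 1))) * (∏ j ∈ range n, (1 - r ^ (2 * j + 1))) *
      (∏ j ∈ range n, (1 - r ^ (j + 1))) = ∏ j ∈ range (2 * n), (1 - r ^ (j + 1)) := by
  induction n with
  | zero => simp
  | succ n ih =>
    rw [show 2 * (n + 1) = 2 * n + 1 + 1 by ring, prod_range_succ, prod_range_succ, prod_range_succ,
      prod_range_succ, prod_range_succ, ← ih]
    ring

open Finset in
/-- A finite form of Euler's identity between distinct and odd parts. -/
theorem prod_one_add_pow_le_prod_inv (r : ℝ) (h0 : 0 ≤ r) (h1 : r < 1) (n : ℕ) :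
    ∏ j ∈ range n, (1 + r ^ (j + 1)) ≤ ∏ j ∈ range n, (1 - r ^ (2 * j + 1))⁻¹ := by
  have hpos : ∀ k : ℕ, 0 < 1 - r ^ (k + 1) := fun k =>
    sub_pos.2 (pow_lt_one₀ h0 h1 (Nat.succ_ne_zero k))
  have hA : 0 < ∏ j ∈ range n, (1 - r ^ (j + 1)) := prod_pos fun j _ => hpos j
  have hB : 0 < ∏ j ∈ range n, (1 - r ^ (2 * j + 1)) := prod_pos fun j _ => hpos (2 * j)
  have key := prod_one_add_pow_mul_prod_one_sub_pow r n
  have hle : ∏ j ∈ range (2 * n), (1 - r ^ (j + 1)) ≤ ∏ j ∈ range n, (1 - r ^ (j + 1)) := by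
    rw [two_mul, prod_range_add]
    refine mul_le_of_le_one_right hA.le (prod_le_one (fun j _ => (hpos _).le) fun j _ => ?_)
    have := pow_nonneg h0 (n + j + 1)
    linarith
  rw [← key] at hle
  rw [prod_inv_distrib, ← one_div, le_div_iff₀ hB]
  exact le_of_mul_le_mul_right (by simpa using hle) hA

-- The full series is 1/(2 sinh v), and sinh v ≥ v.
open Finset in
theorem sum_exp_neg_odd_le (v : ℝ) (hv : 0 < v) (n : ℕ) :
    ∑ j ∈ range n, Real.exp (-v) ^ (2 * j + 1) ≤ 1 / (2 * v) := by
  set u := Real.exp (-v) with hu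
  have hu0 : 0 < u := Real.exp_pos _
  have hu1 : u < 1 := by rw [hu]; exact Real.exp_lt_one_iff.2 (by linarith)
  have hid : (∑ j ∈ range n, u ^ (2 * j + 1)) * (1 - u ^ 2) = u * (1 - u ^ (2 * n)) := by
    induction n with
    | zero => simp
    | succ n ih => rw [sum_range_succ, add_mul, ih]; ring
  have hs : 2 * v * u ≤ 1 - u ^ 2 := by
    have h1 : v ≤ Real.sinh v := Real.self_le_sinh_iff.2 hv.le
    rw [Real.sinh_eq] at h1
    have h2 : Real.exp v * u = 1 := by rw [hu, ← Real.exp_add]; simp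
    nlinarith
  have hu2 : 0 < 1 - u ^ 2 := by nlinarith
  have hn : 0 ≤ u ^ (2 * n) := by positivity
  rw [le_div_iff₀ (by positivity)]
  refine le_of_mul_le_mul_right ?_ hu2
  calc (∑ j ∈ range n, u ^ (2 * j + 1)) * (2 * v) * (1 - u ^ 2)
      = (u * (1 - u ^ (2 * n))) * (2 * v) := by rw [← hid]; ring
    _ ≤ 1 * (1 - u ^ 2) := by nlinarith [mul_nonneg (mul_nonneg hv.le hu0.le) hn]

-- Expand -log(1 - r^(2j+1)) in powers and sum over j first: the k-th term is at most 1/(2k²t), and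
-- ζ(2) = π²/6 gives the exponent.
open Finset in
theorem prod_inv_one_sub_exp_odd_le (t : ℝ) (ht : 0 < t) (n : ℕ) :
    ∏ j ∈ range n, (1 - Real.exp (-t) ^ (2 * j + 1))⁻¹ ≤ Real.exp (Real.pi ^ 2 / (12 * t)) := by
  set r := Real.exp (-t) with hr
  have hr0 : 0 < r := Real.exp_pos _
  have hr1 : r < 1 := by rw [hr]; exact Real.exp_lt_one_iff.2 (by linarith)
  have hlt : ∀ j : ℕ, r ^ (2 * j + 1) < 1 := fun j => pow_lt_one₀ hr0.le hr1 (by omega)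
  have hlog : ∀ j : ℕ, (1 - r ^ (2 * j + 1))⁻¹ = Real.exp (-Real.log (1 - r ^ (2 * j + 1))) :=
    fun j => by rw [Real.exp_neg, Real.exp_log (sub_pos.2 (hlt j))]
  simp_rw [hlog]
  rw [← Real.exp_sum]
  refine Real.exp_le_exp.2 ?_
  have h1 : HasSum (fun k : ℕ => ∑ j ∈ range n, (r ^ (2 * j + 1)) ^ (k + 1) / ((k : ℝ) + 1))
      (∑ j ∈ range n, -Real.log (1 - r ^ (2 * j + 1))) :=
    hasSum_sum fun j _ => Real.hasSum_pow_div_log_of_abs_lt_one (by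
      rw [abs_of_pos (by positivity)]; exact hlt j)
  have h2 : HasSum (fun k : ℕ => 1 / (2 * t) * (1 / (((k + 1 : ℕ) : ℝ)) ^ 2))
      (1 / (2 * t) * (Real.pi ^ 2 / 6)) := by
    refine HasSum.mul_left _ ?_
    have := (hasSum_nat_add_iff' 1).2 hasSum_zeta_two
    simpa using this
  rw [show Real.pi ^ 2 / (12 * t) = 1 / (2 * t) * (Real.pi ^ 2 / 6) by field_simp; norm_num]
  refine hasSum_le (fun k => ?_) h1 h2
  have hk : (0 : ℝ) < (k : ℝ) + 1 := by positivity
  have h3 := sum_exp_neg_odd_le (((k : ℝ) + 1) * t) (by positivity) n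
  have h4 : Real.exp (-(((k : ℝ) + 1) * t)) = r ^ (k + 1) := by
    rw [hr, ← Real.exp_nat_mul]; congr 1; push_cast; ring
  rw [h4] at h3
  rw [← sum_div, div_le_iff₀ hk]
  calc ∑ j ∈ range n, (r ^ (2 * j + 1)) ^ (k + 1)
      = ∑ j ∈ range n, (r ^ (k + 1)) ^ (2 * j + 1) :=
        sum_congr rfl fun j _ => by rw [← pow_mul, ← pow_mul, mul_comm]
    _ ≤ _ := h3
    _ = _ := by push_cast; field_simp

open Finset in
theorem prod_range_one_add_exp_pow_le (t : ℝ) (ht : 0 < t) (n : ℕ) :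
    ∏ j ∈ range n, (1 + Real.exp (-t) ^ j) ≤ 2 * Real.exp (Real.pi ^ 2 / (12 * t)) := by
  have hexp : (1 : ℝ) ≤ Real.exp (Real.pi ^ 2 / (12 * t)) := Real.one_le_exp (by positivity)
  cases n with
  | zero => simp; linarith
  | succ n =>
    rw [prod_range_succ']
    have := (prod_one_add_pow_le_prod_inv (Real.exp (-t)) (Real.exp_pos _).le
      (Real.exp_lt_one_iff.2 (by linarith)) n).trans (prod_inv_one_sub_exp_odd_le t ht n)
    simp only [pow_zero]
    linarith

/-! ### Cosine sums and the saving in a single factor -/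

open Finset in
theorem sum_cos_two_mul (α : ℝ) (N : ℕ) :
    2 * Real.sin α * ∑ j ∈ range N, Real.cos (2 * ((j : ℝ) + 1) * α) =
      Real.sin ((2 * N + 1) * α) - Real.sin α := by
  induction N with
  | zero => simp
  | succ N ih =>
    rw [sum_range_succ, mul_add, ih]
    have h1 := Real.two_mul_sin_mul_cos α (2 * ((N : ℝ) + 1) * α)
    have e1 : α - 2 * ((N : ℝ) + 1) * α = -((2 * N + 1) * α) := by ring
    have e2 : α + 2 * ((N : ℝ) + 1) * α = (2 * ((N + 1 : ℕ) : ℝ) + 1) * α := by push_cast; ring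
    rw [e1, e2, Real.sin_neg] at h1
    linarith

theorem two_mul_abs_le_abs_sin (x : ℝ) (hx : |x| ≤ 1 / 2) :
    2 * |x| ≤ |Real.sin (Real.pi * x)| := by
  have hpi := Real.pi_pos
  have h := Real.mul_le_sin (x := Real.pi * |x|) (by positivity) (by nlinarith)
  have h2 : 2 / Real.pi * (Real.pi * |x|) = 2 * |x| := by field_simp
  rw [h2] at h
  refine h.trans ?_
  rcases abs_cases x with ⟨e, _⟩ | ⟨e, _⟩ <;> rw [e]
  · exact le_abs_self _
  · rw [mul_neg, Real.sin_neg]; exact neg_le_abs _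

-- By the Dirichlet kernel and |sin πx| ≥ 2|x|, the cosines with 1 ≤ j ≤ N sum to at most 1/(4|x|).
-- The term j = 0 vanishes, hence N and not N + 1.
open Finset in
theorem le_sum_one_sub_cos (x : ℝ) (hx0 : 0 < |x|) (hx : |x| ≤ 1 / 2) (N : ℕ) :
    (N : ℝ) - 1 / (4 * |x|) ≤ ∑ j ∈ range (N + 1), (1 - Real.cos (2 * Real.pi * j * x)) := by
  have hs := two_mul_abs_le_abs_sin x hx
  have hs0 : 0 < |Real.sin (Real.pi * x)| := by linarith
  have hne : Real.sin (Real.pi * x) ≠ 0 := abs_pos.1 hs0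
  have h := sum_cos_two_mul (Real.pi * x) N
  set S := ∑ j ∈ range N, Real.cos (2 * ((j : ℝ) + 1) * (Real.pi * x)) with hS
  have hSle : S ≤ 1 / (4 * |x|) := by
    have h1 : S = (Real.sin ((2 * N + 1) * (Real.pi * x)) / Real.sin (Real.pi * x) - 1) / 2 := by
      rw [eq_div_iff two_ne_zero, eq_sub_iff_add_eq, eq_div_iff hne]
      linarith
    have h2 : Real.sin ((2 * N + 1) * (Real.pi * x)) / Real.sin (Real.pi * x) ≤ 1 / (2 * |x|) := by
      refine (le_abs_self _).trans ?_
      rw [abs_div]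
      exact div_le_div₀ zero_le_one (Real.abs_sin_le_one _) (by positivity) hs
    have h3 : 1 / (4 * |x|) = 1 / (2 * |x|) / 2 := by field_simp; norm_num
    rw [h1, h3]
    linarith
  rw [sum_range_succ']
  have h5 : ∑ j ∈ range N, (1 - Real.cos (2 * Real.pi * ((j + 1 : ℕ) : ℝ) * x)) = N - S := by
    rw [sum_sub_distrib, hS]
    simp only [sum_const, card_range, nsmul_eq_mul, mul_one, sub_right_inj]
    refine sum_congr rfl fun j _ => ?_
    push_cast
    congr 1; ring
  rw [h5]
  simp
  linarith [hSle, show 1 / (4 * |x|) = |x|⁻¹ * 4⁻¹ by field_simp]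

/-- The squared norm is (1 + r)² - 2r(1 - cos θ). Since s(1 + r)² ≤ 4s ≤ r, the inequality 1 + u ≤
e^u turns this deficit into the exponential. -/
theorem norm_one_add_le (r θ s : ℝ) (hs : 4 * s ≤ r) (hr1 : r ≤ 1) (hr : 0 ≤ r) :
    ‖1 + (r : ℂ) * Complex.exp (θ * Complex.I)‖ ≤
      (1 + r) * Real.exp (-s * (1 - Real.cos θ)) := by
  have hc := Real.cos_le_one θ
  have hc' := Real.neg_one_le_cos θ
  refine le_of_sq_le_sq ?_ (by positivity)
  have e1 : ‖1 + (r : ℂ) * Complex.exp (θ * Complex.I)‖ ^ 2 =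
      (1 + r) ^ 2 - 2 * r * (1 - Real.cos θ) := by
    rw [← Complex.normSq_eq_norm_sq, Complex.normSq_apply, Complex.exp_mul_I,
      ← Complex.ofReal_cos, ← Complex.ofReal_sin]
    simp only [Complex.add_re, Complex.add_im, Complex.mul_re, Complex.mul_im, Complex.one_re,
      Complex.one_im, Complex.ofReal_re, Complex.ofReal_im, Complex.I_re, Complex.I_im]
    linear_combination r ^ 2 * Real.sin_sq_add_cos_sq θ
  rw [e1, mul_pow, ← Real.exp_nat_mul]
  have h2 := Real.add_one_le_exp (((2 : ℕ) : ℝ) * (-s * (1 - Real.cos θ)))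
  push_cast at h2 ⊢
  have h3 : (1 + r) ^ 2 * (2 * (-s * (1 - Real.cos θ)) + 1) ≤
      (1 + r) ^ 2 * Real.exp (2 * (-s * (1 - Real.cos θ))) :=
    mul_le_mul_of_nonneg_left h2 (by positivity)
  refine le_trans ?_ h3
  have h4 : s * (1 + r) ^ 2 ≤ r := by nlinarith [mul_nonneg hr hr, mul_nonneg hr (sub_nonneg.2 hr1)]
  nlinarith [mul_le_mul_of_nonneg_right h4 (sub_nonneg.2 hc)]

/-- Lets the missing factors j < m be put back into a product, so that the bound is uniform in m. -/
theorem one_le_one_add_mul_exp (r θ s : ℝ) (hs0 : 0 ≤ s) (hs : 4 * s ≤ r) (hr1 : r ≤ 1) :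
    1 ≤ (1 + r) * Real.exp (-s * (1 - Real.cos θ)) := by
  have hc' := Real.neg_one_le_cos θ
  have h2 := Real.add_one_le_exp (-s * (1 - Real.cos θ))
  have h3 : 1 - 2 * s ≤ Real.exp (-s * (1 - Real.cos θ)) := by nlinarith
  have h4 : (1 + r) * (1 - 2 * s) ≤ (1 + r) * Real.exp (-s * (1 - Real.cos θ)) :=
    mul_le_mul_of_nonneg_left h3 (by linarith)
  nlinarith

/-! ### Odd-even overpartitions as marked sets with odd minimum -/

/-- The smallest element of `S` is odd. -/
def HasOddMin (S : Finset ℕ) : Prop := ∃ m ∈ S, Odd m ∧ ∀ j ∈ S, m ≤ j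

/-- The overline marks of an odd-even overpartition are forced by its parts, except for the mark
of the largest part, which is `b`. -/
def overlineMarks : Bool → List ℕ → List (ℕ × Bool)
  | _, [] => []
  | b, a :: t => (a, b) :: overlineMarks (decide (Even (a - t.headD 0))) t

theorem map_fst_overlineMarks (L : List ℕ) : ∀ b, (overlineMarks b L).map Prod.fst = L := by
  induction L with
  | nil => intro b; rfl
  | cons a t ih => intro b; simp [overlineMarks, ih]

theorem isChain_overlineMarks (L : List ℕ) (hL : L.Pairwise (· > ·)) : ∀ b,
    (overlineMarks b L).IsChain
      (fun p r => r.1 < p.1 ∧ (r.2 = true ↔ Even (p.1 - r.1))) := by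
  induction L with
  | nil => intro b; simp [overlineMarks]
  | cons a t ih =>
    intro b
    rw [List.pairwise_cons] at hL
    cases t with
    | nil => simp [overlineMarks]
    | cons c t =>
      have h := ih hL.2 (decide (Even (a - c)))
      have hc := hL.1 c (by simp)
      simp only [overlineMarks, List.headD_cons] at h ⊢
      refine List.IsChain.cons_cons ?_ h
      exact ⟨hc, decide_eq_true_iff⟩

theorem eq_overlineMarks (P : List (ℕ × Bool))
    (hP : P.IsChain (fun p r => r.1 < p.1 ∧ (r.2 = true ↔ Even (p.1 - r.1)))) :
    P = overlineMarks ((P.map Prod.snd).headD false) (P.map Prod.fst) := by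
  induction P with
  | nil => rfl
  | cons p t ih =>
    have h := ih hP.tail
    cases t with
    | nil => rfl
    | cons r t =>
      have hr := (List.isChain_cons_cons.1 hP).1.2
      have hb : r.2 = decide (Even (p.1 - r.1)) := by
        rw [Bool.eq_iff_iff, hr]; simp
      simp only [List.map_cons, List.headD_cons] at h ⊢
      rw [overlineMarks, List.headD_cons, ← hb, ← h]

/-- A repeated part would have difference 0, which is even, so its later copy would be overlined;
only first occurrences may be. -/
theorem Overpartition.IsOddEven.isChain {n : ℕ} {l : Overpartition n} (h : l.IsOddEven) :
    l.parts.IsChain (fun p r => r.1 < p.1 ∧ (r.2 = true ↔ Even (p.1 - r.1))) := by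
  have h1 := l.nonincreasing.isChain
  have h2 := l.overlined_first.isChain
  have h3 := h.2
  rw [List.isChain_iff_getElem] at h1 h2 h3 ⊢
  intro i hi
  have a1 := h1 i hi
  have a2 := h2 i hi
  have a3 := h3 i hi
  generalize l.parts[i] = p at *
  generalize l.parts[i + 1] = r at *
  rcases hr : r.2 with _ | _
  · have := a3.2 hr
    refine ⟨?_, by simpa using this⟩
    rcases this with ⟨k, hk⟩
    omega
  · have := a3.1 hr
    have := a2 hr
    refine ⟨by omega, by simp [*]⟩

theorem pairwise_gt_of_isChain {P : List (ℕ × Bool)}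
    (hP : P.IsChain (fun p r => r.1 < p.1 ∧ (r.2 = true ↔ Even (p.1 - r.1)))) :
    (P.map Prod.fst).Pairwise (· > ·) := by
  rw [← List.isChain_iff_pairwise, List.isChain_map]
  exact hP.imp fun _ _ h => h.1

theorem hasOddMin_toFinset_iff (L : List ℕ) (hL : L.Pairwise (· > ·)) (hne : L ≠ []) :
    HasOddMin L.toFinset ↔ ∀ a ∈ L.getLast?, Odd a := by
  have hlast : ∀ j ∈ L, L.getLast hne ≤ j := by
    intro j hj
    rw [← List.dropLast_append_getLast hne, List.pairwise_append] at hL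
    rw [← List.dropLast_append_getLast hne, List.mem_append] at hj
    rcases hj with hj | hj
    · exact (hL.2.2 j hj _ (by simp)).le
    · rw [List.mem_singleton] at hj; exact hj.ge
  rw [List.getLast?_eq_some_getLast hne]
  simp only [Option.mem_def, Option.some.injEq, forall_eq']
  constructor
  · rintro ⟨m, hm, hodd, hmin⟩
    have e : m = L.getLast hne := le_antisymm (hmin _ (by simp)) (hlast _ (by simpa using hm))
    rwa [← e]
  · intro h
    exact ⟨_, by simp, h, fun j hj => hlast j (by simpa using hj)⟩

theorem HasOddMin.pos {S : Finset ℕ} (h : HasOddMin S) {j : ℕ} (hj : j ∈ S) : 0 < j := by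
  obtain ⟨m, _, hodd, hmin⟩ := h
  exact hodd.pos.trans_le (hmin j hj)

/-- The odd-even overpartition with given largest mark and given set of parts. -/
def Overpartition.ofFinset {n : ℕ} (b : Bool) (S : Finset ℕ) (hS : HasOddMin S)
    (hn : ∑ j ∈ S, j = n) : Overpartition n where
  parts := overlineMarks b (S.sort (· ≥ ·))
  parts_pos p hp := by
    refine hS.pos ((S.mem_sort (· ≥ ·)).1 ?_)
    rw [← map_fst_overlineMarks (S.sort (· ≥ ·)) b]
    exact List.mem_map_of_mem hp
  sum_parts := by
    rw [map_fst_overlineMarks, ← hn, (S.sort_perm_toList (· ≥ ·)).sum_eq]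
    simp
  nonincreasing := by
    have h := pairwise_gt_of_isChain (isChain_overlineMarks _ S.sortedGT_sort.pairwise b)
    rw [List.pairwise_map] at h
    exact h.imp fun h => le_of_lt h
  overlined_first := by
    have h := pairwise_gt_of_isChain (isChain_overlineMarks _ S.sortedGT_sort.pairwise b)
    rw [List.pairwise_map] at h
    refine h.imp ?_
    intro p r h _
    exact ne_of_lt h

theorem Overpartition.isOddEven_ofFinset {n : ℕ} (b : Bool) (S : Finset ℕ) (hS : HasOddMin S)
    (hn : ∑ j ∈ S, j = n) : (Overpartition.ofFinset b S hS hn).IsOddEven := by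
  have hne : S.sort (· ≥ ·) ≠ [] := by
    obtain ⟨m, hm, -⟩ := hS
    exact List.ne_nil_of_mem ((S.mem_sort (· ≥ ·)).2 hm)
  constructor
  · have h := (hasOddMin_toFinset_iff _ S.sortedGT_sort.pairwise hne).1 (by simpa using hS)
    rw [← map_fst_overlineMarks (S.sort (· ≥ ·)) b, List.getLast?_map] at h
    intro p hp
    exact h p.1 (Option.mem_map_of_mem _ hp)
  · refine (isChain_overlineMarks _ S.sortedGT_sort.pairwise b).imp fun p r h => ⟨h.2.1, fun hr => ?_⟩
    rw [← Nat.not_even_iff_odd, ← h.2, hr]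
    simp

open Classical in
/-- Odd-even overpartitions of `n > 0` correspond to sets of positive integers with sum `n` and
odd minimum, together with the mark of the largest part. -/
theorem oddEvenOverpartitionCount_eq_two_mul (n : ℕ) (hn : n ≠ 0) :
    oddEvenOverpartitionCount n =
      2 * Nat.card {S : {S : Finset ℕ // HasOddMin S} // ∑ j ∈ S.1, j = n} := by
  have hne : ∀ l : Overpartition n, l.parts.map Prod.fst ≠ [] := by
    intro l h
    have := l.sum_parts
    rw [h] at this
    exact hn this.symm
  let e : Bool × {S : {S : Finset ℕ // HasOddMin S} // ∑ j ∈ S.1, j = n} →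
      {l : Overpartition n // l.IsOddEven} := fun p =>
    ⟨Overpartition.ofFinset p.1 p.2.1.1 p.2.1.2 p.2.2,
      Overpartition.isOddEven_ofFinset p.1 p.2.1.1 p.2.1.2 p.2.2⟩
  have he : Function.Bijective e := by
    constructor
    · rintro ⟨b, ⟨S, hS⟩, hs⟩ ⟨b', ⟨S', hS'⟩, hs'⟩ h
      have h1 : overlineMarks b (S.sort (· ≥ ·)) = overlineMarks b' (S'.sort (· ≥ ·)) :=
        congrArg (fun l => l.1.parts) h
      have h2 := congrArg (List.map Prod.fst) h1
      rw [map_fst_overlineMarks, map_fst_overlineMarks] at h2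
      have h3 : S = S' := by
        rw [← S.sort_toFinset (· ≥ ·), h2, S'.sort_toFinset]
      subst h3
      -- The set is nonempty, so the mark can be read off the head of the list.
      obtain ⟨m, hm, -⟩ := hS
      obtain ⟨a, t, hat⟩ := List.exists_cons_of_ne_nil
        (List.ne_nil_of_mem ((S.mem_sort (· ≥ ·)).2 hm))
      rw [hat] at h1
      simp only [overlineMarks, List.cons.injEq, Prod.mk.injEq, true_and, and_true] at h1
      simp [h1]
    · rintro ⟨l, hl⟩
      have hgt := pairwise_gt_of_isChain hl.isChain
      have hsort : (l.parts.map Prod.fst).toFinset.sort (· ≥ ·) = l.parts.map Prod.fst :=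
        (List.toFinset_sort _ (hgt.imp fun h => ne_of_gt h)).2 (hgt.imp fun h => le_of_lt h)
      have hodd : HasOddMin (l.parts.map Prod.fst).toFinset := by
        rw [hasOddMin_toFinset_iff _ hgt (hne l), List.getLast?_map]
        intro a ha
        obtain ⟨p, hp, rfl⟩ := Option.mem_map.1 ha
        exact hl.1 p hp
      have hsum : ∑ j ∈ (l.parts.map Prod.fst).toFinset, j = n := by
        rw [List.sum_toFinset _ (hgt.imp fun h => ne_of_gt h), List.map_id', l.sum_parts]
      set p : Bool × {S : {S : Finset ℕ // HasOddMin S} // ∑ j ∈ S.1, j = n} :=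
        ((l.parts.map Prod.snd).headD false, ⟨⟨_, hodd⟩, hsum⟩)
      refine ⟨p, ?_⟩
      have hparts : (e p).1.parts = l.parts := by
        change overlineMarks _ ((l.parts.map Prod.fst).toFinset.sort (· ≥ ·)) = _
        rw [hsort]
        exact (eq_overlineMarks _ hl.isChain).symm
      apply Subtype.ext
      generalize (e p).1 = l' at hparts
      cases l; cases l'; simp_all
  rw [oddEvenOverpartitionCount, ← Nat.card_congr (Equiv.ofBijective e he), Nat.card_prod]
  simp

theorem oddEvenOverpartitionCount_zero : oddEvenOverpartitionCount 0 = 1 := by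
  have hnil : ∀ l : Overpartition 0, l.parts = [] := by
    intro l
    rw [List.eq_nil_iff_forall_not_mem]
    intro p hp
    have h1 := List.single_le_sum (by simp) _ (List.mem_map_of_mem (f := Prod.fst) hp)
    rw [l.sum_parts] at h1
    exact absurd (l.parts_pos p hp) (by omega)
  rw [oddEvenOverpartitionCount, Nat.card_eq_one_iff_unique]
  refine ⟨⟨fun a b => ?_⟩, ⟨⟨⟨[], by simp, by simp, by simp, by simp⟩, ?_⟩⟩⟩
  · have ha := hnil a.1
    have hb := hnil b.1
    rcases a with ⟨⟨⟩, _⟩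
    rcases b with ⟨⟨⟩, _⟩
    simp_all
  · simp [Overpartition.IsOddEven]

theorem card_hasOddMin_sum_zero :
    Nat.card {S : {S : Finset ℕ // HasOddMin S} // ∑ j ∈ S.1, j = 0} = 0 := by
  have : IsEmpty {S : {S : Finset ℕ // HasOddMin S} // ∑ j ∈ S.1, j = 0} := by
    refine ⟨fun ⟨⟨S, hS⟩, h⟩ => ?_⟩
    obtain ⟨m, hm, -⟩ := id hS
    exact (hS.pos hm).ne' (Finset.sum_eq_zero_iff.1 h m hm)
  exact Nat.card_of_isEmpty

/-! ### Generating function, sorted by the minimum -/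

theorem hasOddMin_insert_iff {N : ℕ} {S : Finset ℕ} (hS : S ⊆ Finset.range N) :
    HasOddMin (insert N S) ↔ HasOddMin S ∨ (S = ∅ ∧ Odd N) := by
  have hlt : ∀ j ∈ S, j < N := fun j hj => Finset.mem_range.1 (hS hj)
  constructor
  · rintro ⟨m, hm, hodd, hmin⟩
    rcases Finset.mem_insert.1 hm with rfl | hm
    · right
      refine ⟨Finset.eq_empty_of_forall_notMem fun j hj => ?_, hodd⟩
      exact absurd (hlt j hj) (hmin j (Finset.mem_insert_of_mem hj)).not_gt
    · exact Or.inl ⟨m, hm, hodd, fun j hj => hmin j (Finset.mem_insert_of_mem hj)⟩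
  · rintro (⟨m, hm, hodd, hmin⟩ | ⟨rfl, hodd⟩)
    · refine ⟨m, Finset.mem_insert_of_mem hm, hodd, fun j hj => ?_⟩
      rcases Finset.mem_insert.1 hj with rfl | hj
      · exact (hlt m hm).le
      · exact hmin j hj
    · exact ⟨N, by simp, hodd, by simp⟩

theorem not_hasOddMin_empty : ¬ HasOddMin ∅ := by
  rintro ⟨m, hm, -⟩
  simp at hm

-- A set with minimum m contributes q^m, and each larger j < N is freely in or out. In the
-- induction, adjoining N changes the minimum only of the empty set.
open Classical Finset in
theorem sum_powerset_range_hasOddMin (q : ℂ) (N : ℕ) :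
    ∑ S ∈ (range N).powerset, (if HasOddMin S then ∏ j ∈ S, q ^ j else 0) =
      ∑ m ∈ range N, (if Odd m then q ^ m else 0) * ∏ j ∈ Ico (m + 1) N, (1 + q ^ j) := by
  induction N with
  | zero => simp [not_hasOddMin_empty]
  | succ N ih =>
    have hins : ∑ S ∈ (range N).powerset,
        (if HasOddMin (insert N S) then ∏ j ∈ insert N S, q ^ j else 0) =
        q ^ N * ∑ S ∈ (range N).powerset, (if HasOddMin S then ∏ j ∈ S, q ^ j else 0) +
          if Odd N then q ^ N else 0 := by
      have h0 : (if Odd N then q ^ N else 0) =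
          ∑ S ∈ (range N).powerset, if S = ∅ then (if Odd N then q ^ N else 0) else 0 := by
        rw [sum_ite_eq' _ (∅ : Finset ℕ)]
        simp
      rw [h0, mul_sum, ← sum_add_distrib]
      refine sum_congr rfl fun S hS => ?_
      have hS' := mem_powerset.1 hS
      have hN : N ∉ S := fun h => by simpa using hS' h
      rw [prod_insert hN]
      simp only [hasOddMin_insert_iff hS']
      by_cases hE : S = ∅
      · subst hE
        simp [not_hasOddMin_empty]
      · simp [hE]
    rw [range_add_one, sum_powerset_insert (by simp), hins, ih, sum_insert (by simp)]
    rw [show ∑ m ∈ range N, (if Odd m then q ^ m else 0) * ∏ j ∈ Ico (m + 1) (N + 1), (1 + q ^ j) =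
      (1 + q ^ N) * ∑ m ∈ range N, (if Odd m then q ^ m else 0) * ∏ j ∈ Ico (m + 1) N, (1 + q ^ j)
      from ?_]
    · simp
      ring
    · rw [mul_sum]
      refine sum_congr rfl fun m hm => ?_
      rw [prod_Ico_succ_top (by simpa using hm)]
      ring

theorem summable_prod_pow (q : ℂ) (hq : ‖q‖ < 1) :
    Summable (fun S : Finset ℕ => ∏ j ∈ S, q ^ j) := by
  refine Summable.of_norm ?_
  have h := summable_finsetProd_of_summable_nonneg (f := fun j : ℕ => ‖q‖ ^ j)
    (fun j => by positivity) (summable_geometric_of_lt_one (norm_nonneg _) hq)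
  simpa [norm_prod, norm_pow] using h

-- Group the absolutely convergent sum over sets by ∑S. The separate 1 is the empty overpartition,
-- which has no largest part to mark.
open Classical in
theorem hasSum_oddEvenOverpartitionCount (q : ℂ) (hq : ‖q‖ < 1) :
    HasSum (fun n : ℕ => (oddEvenOverpartitionCount n : ℂ) * q ^ n)
      (1 + 2 * ∑' S : Finset ℕ, if HasOddMin S then ∏ j ∈ S, q ^ j else 0) := by
  have h1 : Summable (fun S : Finset ℕ => if HasOddMin S then ∏ j ∈ S, q ^ j else 0) :=
    ((summable_prod_pow q hq).indicator {S | HasOddMin S}).congr fun S => by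
      simp [Set.indicator_apply]
  have h2 : HasSum (fun S : {S : Finset ℕ // HasOddMin S} => ∏ j ∈ S.1, q ^ j)
      (∑' S : Finset ℕ, if HasOddMin S then ∏ j ∈ S, q ^ j else 0) := by
    have := hasSum_subtype_iff_indicator (f := fun S : Finset ℕ => ∏ j ∈ S, q ^ j)
      (s := {S | HasOddMin S}) (a := ∑' S : Finset ℕ, if HasOddMin S then ∏ j ∈ S, q ^ j else 0)
    refine this.2 (h1.hasSum.congr_fun fun S => ?_)
    simp [Set.indicator_apply]
  have h3 := h2.tsum_fiberwise (fun S => ∑ j ∈ S.1, j)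
  have h4 : ∀ n : ℕ, ∑' S : (fun S : {S : Finset ℕ // HasOddMin S} => ∑ j ∈ S.1, j) ⁻¹' {n},
      ∏ j ∈ S.1.1, q ^ j =
        (Nat.card {S : {S : Finset ℕ // HasOddMin S} // ∑ j ∈ S.1, j = n} : ℂ) * q ^ n := by
    intro n
    have : ∀ S : (fun S : {S : Finset ℕ // HasOddMin S} => ∑ j ∈ S.1, j) ⁻¹' {n},
        ∏ j ∈ S.1.1, q ^ j = q ^ n := fun S => by
      rw [Finset.prod_pow_eq_pow_sum]
      congr 1
      exact S.2
    rw [tsum_congr this, tsum_const, nsmul_eq_mul]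
    rfl
  simp_rw [h4] at h3
  have h5 : HasSum (fun n : ℕ => if n = 0 then (1 : ℂ) else 0) 1 := hasSum_ite_eq 0 1
  refine (h5.add (h3.mul_left 2)).congr_fun fun n => ?_
  rcases eq_or_ne n 0 with rfl | hn
  · rw [oddEvenOverpartitionCount_zero, card_hasOddMin_sum_zero]
    simp
  · rw [oddEvenOverpartitionCount_eq_two_mul n hn, if_neg hn]
    push_cast
    ring

-- The powersets of initial segments exhaust all finite sets, so the finite identity passes to the
-- limit.
open Classical Finset in
theorem norm_tsum_hasOddMin_le (q : ℂ) (hq : ‖q‖ < 1) (B : ℝ)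
    (hB : ∀ᶠ N : ℕ in Filter.atTop, ‖∑ m ∈ range N, (if Odd m then q ^ m else 0) *
      ∏ j ∈ Ico (m + 1) N, (1 + q ^ j)‖ ≤ B) :
    ‖∑' S : Finset ℕ, if HasOddMin S then ∏ j ∈ S, q ^ j else 0‖ ≤ B := by
  have h1 : Summable (fun S : Finset ℕ => if HasOddMin S then ∏ j ∈ S, q ^ j else 0) :=
    ((summable_prod_pow q hq).indicator {S | HasOddMin S}).congr fun S => by
      simp [Set.indicator_apply]
  have h2 := (h1.hasSum.comp
    (Filter.tendsto_finset_powerset_atTop_atTop.comp Filter.tendsto_finset_range)).norm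
  refine le_of_tendsto h2 (hB.mono fun N hN => ?_)
  simp only [Function.comp_apply]
  rwa [sum_powerset_range_hasOddMin]

/-! ### Estimates for |x| > My -/

open Finset in
theorem prod_Ico_norm_one_add_pow_le (x t s : ℝ) (ht : 0 < t) (hs0 : 0 ≤ s) (q : ℂ)
    (hq : q = (Real.exp (-t) : ℂ) * Complex.exp ((2 * Real.pi * x : ℝ) * Complex.I)) (N m n : ℕ)
    (hs : 4 * s ≤ Real.exp (-t) ^ N) (hm : m ≤ n) (hN : N + 1 ≤ n) :
    ∏ j ∈ Ico m n, ‖1 + q ^ j‖ ≤ 2 * Real.exp (Real.pi ^ 2 / (12 * t)) *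
      Real.exp (-s * ∑ j ∈ range (N + 1), (1 - Real.cos (2 * Real.pi * j * x))) := by
  set r := Real.exp (-t) with hr
  have hr0 : 0 < r := Real.exp_pos _
  have hr1 : r ≤ 1 := Real.exp_le_one_iff.2 (by linarith)
  have hqj : ∀ j : ℕ, q ^ j =
      ((r ^ j : ℝ) : ℂ) * Complex.exp ((2 * Real.pi * j * x : ℝ) * Complex.I) := fun j => by
    rw [hq, mul_pow, ← Complex.exp_nat_mul]
    push_cast
    congr 2
    ring
  -- The saving is claimed only for j ≤ N, where 4s ≤ r^N ≤ r^j; the other factors get the triangle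
  -- inequality.
  set g : ℕ → ℝ := fun j => if j ∈ range (N + 1) then
    -s * (1 - Real.cos (2 * Real.pi * j * x)) else 0 with hg
  have hle : ∀ j, ‖1 + q ^ j‖ ≤ (1 + r ^ j) * Real.exp (g j) := fun j => by
    by_cases hj : j ∈ range (N + 1)
    · have hjN : r ^ N ≤ r ^ j :=
        pow_le_pow_of_le_one hr0.le hr1 (Nat.lt_succ_iff.1 (mem_range.1 hj))
      simp only [hg, if_pos hj]
      rw [hqj]
      exact norm_one_add_le _ _ _ (hs.trans hjN) (pow_le_one₀ hr0.le hr1) (by positivity)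
    · simp only [hg, if_neg hj, Real.exp_zero, mul_one]
      refine (norm_add_le _ _).trans ?_
      rw [hqj, norm_mul, Complex.norm_exp_ofReal_mul_I, Complex.norm_real, norm_one, mul_one,
        Real.norm_of_nonneg (by positivity)]
  have hone : ∀ j, 1 ≤ (1 + r ^ j) * Real.exp (g j) := fun j => by
    by_cases hj : j ∈ range (N + 1)
    · have hjN : r ^ N ≤ r ^ j :=
        pow_le_pow_of_le_one hr0.le hr1 (Nat.lt_succ_iff.1 (mem_range.1 hj))
      simp only [hg, if_pos hj]
      exact one_le_one_add_mul_exp _ _ _ hs0 (hs.trans hjN) (pow_le_one₀ hr0.le hr1)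
    · simp only [hg, if_neg hj, Real.exp_zero, mul_one]
      have : 0 ≤ r ^ j := by positivity
      linarith
  have hnn : ∀ j, 0 ≤ (1 + r ^ j) * Real.exp (g j) := fun j => zero_le_one.trans (hone j)
  have hsum : ∑ j ∈ range n, g j =
      -s * ∑ j ∈ range (N + 1), (1 - Real.cos (2 * Real.pi * j * x)) := by
    rw [mul_sum, hg, sum_ite_mem, inter_eq_right.2 (range_mono hN)]
  calc ∏ j ∈ Ico m n, ‖1 + q ^ j‖
      ≤ ∏ j ∈ Ico m n, ((1 + r ^ j) * Real.exp (g j)) :=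
        prod_le_prod (fun _ _ => norm_nonneg _) fun j _ => hle j
    _ ≤ (∏ j ∈ range m, ((1 + r ^ j) * Real.exp (g j))) *
          ∏ j ∈ Ico m n, ((1 + r ^ j) * Real.exp (g j)) := by
        refine le_mul_of_one_le_left (prod_nonneg fun j _ => hnn j) ?_
        calc (1 : ℝ) = ∏ j ∈ range m, 1 := by simp
          _ ≤ _ := prod_le_prod (fun _ _ => zero_le_one) fun j _ => hone j
    _ = (∏ j ∈ range n, (1 + r ^ j)) * Real.exp (∑ j ∈ range n, g j) := by
        rw [prod_range_mul_prod_Ico _ hm, prod_mul_distrib, Real.exp_sum]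
    _ ≤ _ := by
        rw [hsum]
        exact mul_le_mul_of_nonneg_right (prod_range_one_add_exp_pow_le t ht n)
          (Real.exp_pos _).le

theorem inv_one_sub_exp_neg_le (t : ℝ) (ht : 0 < t) : (1 - Real.exp (-t))⁻¹ ≤ 1 / t + 1 := by
  have h1 : Real.exp (-t) < 1 := Real.exp_lt_one_iff.2 (by linarith)
  have h2 := Real.add_one_le_exp t
  have h3 : Real.exp t * Real.exp (-t) = 1 := by rw [← Real.exp_add]; simp
  have h4 := Real.exp_pos (-t)
  rw [inv_le_iff_one_le_mul₀ (by linarith)]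
  have h5 : (t + 1) * Real.exp (-t) ≤ 1 := by nlinarith
  have h6 : 1 / t + 1 = (1 + t) / t := by field_simp
  rw [h6, div_mul_eq_mul_div, le_div_iff₀ ht]
  nlinarith

open Finset in
theorem norm_oddEvenOverpartitionGF_le (M : ℝ) (hM : 0 < M) (x y s : ℝ) (hy : 0 < y) (hy1 : y < 1)
    (hMx : M * y < |x|) (hx : |x| ≤ 1 / 2) (hs0 : 0 ≤ s)
    (hs : 4 * s ≤ Real.exp (-(2 * Real.pi / M + 2 * Real.pi))) (q : ℂ)
    (hq : q = (Real.exp (-(2 * Real.pi * y)) : ℂ) *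
      Complex.exp ((2 * Real.pi * x : ℝ) * Complex.I)) :
    Summable (fun n : ℕ => (oddEvenOverpartitionCount n : ℂ) * q ^ n) ∧
      ‖oddEvenOverpartitionGF q‖ ≤
        1 + 8 / y * Real.exp ((1 / y) * (Real.pi / 24 - s / (2 * M))) := by
  classical
  have hpi := Real.pi_pos
  have hpi3 := Real.pi_gt_three
  set t := 2 * Real.pi * y with ht_def
  have ht : 0 < t := by positivity
  have hr1 : Real.exp (-t) < 1 := Real.exp_lt_one_iff.2 (by linarith)
  have hnorm : ‖q‖ = Real.exp (-t) := by
    rw [hq, norm_mul, Complex.norm_exp_ofReal_mul_I, Complex.norm_real, mul_one,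
      Real.norm_of_nonneg (Real.exp_pos _).le]
  have hq1 : ‖q‖ < 1 := hnorm ▸ hr1
  have hsum := hasSum_oddEvenOverpartitionCount q hq1
  refine ⟨hsum.summable, ?_⟩
  -- Long enough that N - 1/(4|x|) ≥ 1/(2My), short enough that tN ≤ 2π/M + 2πy, which bounds |q|^N
  -- below independently of x and y.
  set N := ⌈1 / (M * y)⌉₊ with hN
  have hN1 : 1 / (M * y) ≤ N := Nat.le_ceil _
  have hN2 : (N : ℝ) < 1 / (M * y) + 1 := Nat.ceil_lt_add_one (by positivity)
  have hsN : 4 * s ≤ Real.exp (-t) ^ N := by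
    refine hs.trans ?_
    rw [← Real.exp_nat_mul]
    refine Real.exp_le_exp.2 ?_
    have h1 : t * N ≤ t * (1 / (M * y) + 1) := mul_le_mul_of_nonneg_left hN2.le ht.le
    have h2 : t * (1 / (M * y) + 1) = 2 * Real.pi / M + 2 * Real.pi * y := by
      rw [ht_def]; field_simp
    nlinarith
  have hx0 : 0 < |x| := lt_trans (by positivity) hMx
  have hcos := le_sum_one_sub_cos x hx0 hx N
  have hsave : 1 / (2 * M * y) ≤
      ∑ j ∈ range (N + 1), (1 - Real.cos (2 * Real.pi * j * x)) := by
    have h1 : 1 / (4 * |x|) ≤ 1 / (2 * (M * y)) :=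
      one_div_le_one_div_of_le (by positivity) (by nlinarith [mul_pos hM hy])
    have h2 : 1 / (M * y) = 1 / (2 * (M * y)) + 1 / (2 * M * y) := by field_simp; norm_num
    linarith
  set E := Real.exp ((1 / y) * (Real.pi / 24 - s / (2 * M))) with hE
  have hprod : ∀ m n : ℕ, m ≤ n → N + 1 ≤ n → ∏ j ∈ Ico m n, ‖1 + q ^ j‖ ≤ 2 * E := by
    intro m n hm hn
    refine (prod_Ico_norm_one_add_pow_le x t s ht hs0 q hq N m n hsN hm hn).trans ?_
    rw [mul_assoc, ← Real.exp_add]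
    refine mul_le_mul_of_nonneg_left (Real.exp_le_exp.2 ?_) zero_le_two
    have h1 := mul_le_mul_of_nonneg_left hsave hs0
    have h2 : Real.pi ^ 2 / (12 * t) + -(s * (1 / (2 * M * y))) =
        1 / y * (Real.pi / 24 - s / (2 * M)) := by
      rw [ht_def]; field_simp; ring
    linarith
  have hB := norm_tsum_hasOddMin_le q hq1 ((1 - Real.exp (-t))⁻¹ * (2 * E)) (by
    filter_upwards [Filter.eventually_ge_atTop (N + 1)] with n hn
    refine (norm_sum_le _ _).trans ?_
    calc ∑ m ∈ range n, ‖(if Odd m then q ^ m else 0) * ∏ j ∈ Ico (m + 1) n, (1 + q ^ j)‖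
        ≤ ∑ m ∈ range n, Real.exp (-t) ^ m * (2 * E) := by
          refine sum_le_sum fun m hm => ?_
          rw [norm_mul, norm_prod]
          refine mul_le_mul ?_ (hprod _ _ (mem_range.1 hm) hn)
            (prod_nonneg fun _ _ => norm_nonneg _) (by positivity)
          split_ifs
          · rw [norm_pow, hnorm]
          · rw [norm_zero]; positivity
      _ ≤ _ := by
          rw [← sum_mul]
          refine mul_le_mul_of_nonneg_right ?_ (by positivity)
          rw [← tsum_geometric_of_lt_one (Real.exp_pos _).le hr1]
          exact (summable_geometric_of_lt_one (Real.exp_pos _).le hr1).sum_le_tsum _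
            fun _ _ => by positivity)
  -- Summing |q|^m over the minima produces the prefactor 1/y.
  have hgeom : (1 - Real.exp (-t))⁻¹ ≤ 2 / y := by
    refine (inv_one_sub_exp_neg_le t ht).trans ?_
    have h1 : 1 / t ≤ 1 / y := one_div_le_one_div_of_le hy (by rw [ht_def]; nlinarith)
    have h2 : 1 ≤ 1 / y := (one_le_div hy).2 hy1.le
    have h3 : 2 / y = 1 / y + 1 / y := by ring
    linarith
  rw [oddEvenOverpartitionGF, hsum.tsum_eq]
  refine (norm_add_le _ _).trans ?_
  rw [norm_one, norm_mul, Complex.norm_ofNat]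
  have h1 : (1 - Real.exp (-t))⁻¹ * (2 * E) ≤ 2 / y * (2 * E) :=
    mul_le_mul_of_nonneg_right hgeom (by positivity)
  have h2 : 8 / y * E = 2 * (2 / y * (2 * E)) := by ring
  linarith

theorem mainTheorem6 (M : ℝ)
    (hM : Real.sqrt ((12 / (12 - Real.pi ^ 2)) ^ 2 - 1) < M) :
    ∃ ε : ℝ, 0 < ε ∧ ∃ C : ℝ, 0 < C ∧ ∃ y₀ : ℝ, 0 < y₀ ∧
      ∀ x y : ℝ, 0 < y → y < y₀ → M * y < |x| → |x| ≤ 1 / 2 →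
        ∀ τ q : ℂ, τ = (x : ℂ) + (y : ℂ) * Complex.I →
          q = Complex.exp (2 * (Real.pi : ℂ) * Complex.I * τ) →
          Summable (fun n : ℕ => (oddEvenOverpartitionCount n : ℂ) * q ^ n) ∧
            ‖oddEvenOverpartitionGF q‖ ≤
              C * (1 / (y * Real.sqrt 2) * Real.exp ((1 / y) * (Real.pi / 24 - ε))) := by
  have hM0 : 0 < M := (Real.sqrt_nonneg _).trans_lt hM
  have hpi := Real.pi_pos
  set s := Real.exp (-(2 * Real.pi / M + 2 * Real.pi)) / 4 with hs
  have hs0 : 0 < s := by positivity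
  -- The cap π/24 keeps the exponent nonnegative, so the constant term 1 is absorbed: 9 = 8 + 1.
  refine ⟨min (s / (2 * M)) (Real.pi / 24), by positivity, 9 * Real.sqrt 2, by positivity, 1,
    one_pos, ?_⟩
  intro x y hy hy1 hMx hx τ q hτ hq
  have hq' : q = (Real.exp (-(2 * Real.pi * y)) : ℂ) *
      Complex.exp ((2 * Real.pi * x : ℝ) * Complex.I) := by
    rw [hq, hτ, Complex.ofReal_exp, ← Complex.exp_add]
    congr 1
    push_cast
    linear_combination (2 * (Real.pi : ℂ) * y) * Complex.I_sq
  obtain ⟨h1, h2⟩ := norm_oddEvenOverpartitionGF_le M hM0 x y s hy hy1 hMx hx hs0.le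
    (by rw [hs]; linarith) q hq'
  refine ⟨h1, h2.trans ?_⟩
  set E := Real.exp ((1 / y) * (Real.pi / 24 - min (s / (2 * M)) (Real.pi / 24))) with hE
  have hE1 : 1 ≤ E := Real.one_le_exp
    (mul_nonneg (by positivity) (sub_nonneg.2 (min_le_right _ _)))
  have hE2 : Real.exp ((1 / y) * (Real.pi / 24 - s / (2 * M))) ≤ E :=
    Real.exp_le_exp.2 (mul_le_mul_of_nonneg_left
      (sub_le_sub_left (min_le_left _ _) _) (by positivity))
  have h3 : 9 * Real.sqrt 2 * (1 / (y * Real.sqrt 2) * E) = 1 / y * E + 8 / y * E := by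
    field_simp; norm_num
  have h4 : 8 / y * Real.exp ((1 / y) * (Real.pi / 24 - s / (2 * M))) ≤ 8 / y * E :=
    mul_le_mul_of_nonneg_left hE2 (by positivity)
  have h5 : 1 ≤ 1 / y * E := one_le_mul_of_one_le_of_one_le ((one_le_div hy).2 hy1.le) hE1
  linarith
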